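/- **Model.** A GPU is shared by a set of tasks (processes), each owning one time-sliced group (TSG) of GPU commands. A job of task $\tau_i$ has $\eta^g_i$ GPU segments; during the $j$-th one it submits at most $G^e_{i,j}$ units of GPU work. A task is *real-time* if its real-time priority is positive and *best-effort* otherwise; GPU priorities are positive for real-time tasks and $0$ for best-effort tasks. The GPU serves the TSGs on the *runlist* round-robin, in time slices of length $L$, skipping TSGs without commands; moving from one TSG to another costs at most $\theta$. The runlist consists of one entry for every task in a set $\mathit{running}$ that the driver maintains together with a set $\mathit{pending}$; both are empty initially. Each update of the runlist takes at most $\epsilon=\alpha+\theta$. Under GCAPS the driver updates the sets as follows. - When a GPU segment of a best-effort task begins, the task is added to $\mathit{running}$ if that set contains no real-time task, and to $\mathit{pending}$ otherwise. - When a GPU segment of a real-time task $\tau_i$ begins: if $\tau_i$ has higher GPU priority than the highest-priority task(s) in $\mathit{running}$ (or $\mathit{running}$ is empty), then $\tau_i$ is added to $\mathit{running}$ and all those highest-priority tasks are moved to $\mathit{pending}$; otherwise $\tau_i$ is added to $\mathit{pending}$. - A GPU segment of $\tau_i$ ends when its submitted commands have been executed and $\tau_i\in\mathit{running}$. Then $\tau_i$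 is removed from $\mathit{running}$, and a highest-priority real-time task in $\mathit{pending}$ is moved to $\mathit{running}$; if there is no real-time task in $\mathit{pending}$, all tasks in $\mathit{pending}$ are moved to $\mathit{running}$. The *interleaved-execution interference* $I^{ie}_i$ of $\tau_i$ is the supremum, over all executions of the system (with arbitrary behaviour of the tasks on the CPU side) and over all jobs of $\tau_i$ in them, of the total time during the job in which the TSG of $\tau_i$ is on the runlist and has commands to execute, but the GPU executes another TSG of the runlist or is switching from one TSG of the runlist to another in the course of its round-robin service (time spent on runlist updates is not counted). **Lemma (interleaved execution, proposed approach).** Under GCAPS, for every real-time task $\tau_i$: whenever the TSG of $\tau_i$ is on the runlist, it is the only entry of the runlist; and $I^{ie}_i=0$. -/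

import Mathlib

namespace GCAPS

/-- A platform with one GPU together with a set of tasks (processes), each owning one TSG. -/
structure System (Task : Type*) where
  /-- OS-level priority; `0` means that no real-time priority is set (best-effort task). -/
  rtPrio : Task → ℕ
  /-- Priority of the GPU segments of a task (by default it equals `rtPrio`). -/
  gpuPrio : Task → ℕ
  /-- Best-effort tasks share the lowest GPU priority `0`, real-time tasks are above it. -/
  gpuPrio_pos_iff : ∀ i, 0 < gpuPrio i ↔ 0 < rtPrio i
  /-- Number of GPU segments in each job of a task. -/
  numSeg : Task → ℕ
  /-- WCET of the pure GPU part of each GPU segment of a job. -/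
  pureGpu : (i : Task) → Fin (numSeg i) → ℝ
  pureGpu_nonneg : ∀ i j, 0 ≤ pureGpu i j
  /-- Length of a TSG time slice. -/
  slice : ℝ
  slice_pos : 0 < slice
  /-- GPU context switch overhead. -/
  theta : ℝ
  theta_nonneg : 0 ≤ theta
  /-- Cost of one run of the TSG scheduler in the driver. -/
  alpha : ℝ
  alpha_nonneg : 0 ≤ alpha

namespace System

variable {Task : Type*} (S : System Task)

/-- A task is real-time if its real-time priority is set. -/
def IsRealTime (i : Task) : Prop := 0 < S.rtPrio i

instance (i : Task) : Decidable (S.IsRealTime i) :=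
  inferInstanceAs (Decidable (0 < S.rtPrio i))

/-- Runlist update delay. -/
def epsilon : ℝ := S.alpha + S.theta

/-- The tasks of highest GPU priority in a set of tasks (empty for the empty set). -/
def highest (A : Finset Task) : Finset Task :=
  A.filter fun h => ∀ h' ∈ A, S.gpuPrio h' ≤ S.gpuPrio h

end System

/-- The two task lists kept by the driver. -/
structure DriverState (Task : Type*) where
  running : Finset Task
  pending : Finset Task

/-- Requests to the driver: a GPU segment of the task begins, or has been completed. -/
inductive Request (Task : Type*)
  | segBegin (i : Task)
  | segEnd (i : Task)

/-- A driver policy relates the old lists, a request, and the possible new lists. -/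
abbrev Driver (Task : Type*) := DriverState Task → Request Task → DriverState Task → Prop

section Policy

variable {Task : Type*} [DecidableEq Task]

/-- The GCAPS policy. The only freedom is the choice among pending tasks of equal priority. -/
inductive gcaps (S : System Task) : Driver Task
  /-- A best-effort task begins, and no real-time task is running. -/
  | addBestEffortRunning (s : DriverState Task) (i : Task)
      (hi : ¬ S.IsRealTime i) (hr : ∀ h ∈ s.running, ¬ S.IsRealTime h) :
      gcaps S s (.segBegin i) ⟨insert i s.running, s.pending⟩
  /-- A best-effort task begins while a real-time task is running. -/
  | addBestEffortPending (s : DriverState Task) (i : Task)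
      (hi : ¬ S.IsRealTime i) (hr : ∃ h ∈ s.running, S.IsRealTime h) :
      gcaps S s (.segBegin i) ⟨s.running, insert i s.pending⟩
  /-- A real-time task begins and has higher priority than the highest-priority running
  task(s), which are preempted; this includes the case that nothing is running. -/
  | addRealTimeRunning (s : DriverState Task) (i : Task)
      (hi : S.IsRealTime i) (hr : ∀ h ∈ S.highest s.running, S.gpuPrio h < S.gpuPrio i) :
      gcaps S s (.segBegin i)
        ⟨insert i (s.running \ S.highest s.running), s.pending ∪ S.highest s.running⟩
  /-- A real-time task begins and does not have higher priority than the running one. -/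
  | addRealTimePending (s : DriverState Task) (i : Task)
      (hi : S.IsRealTime i) (hr : ∃ h ∈ S.highest s.running, S.gpuPrio i ≤ S.gpuPrio h) :
      gcaps S s (.segBegin i) ⟨s.running, insert i s.pending⟩
  /-- A segment ends, and `k` is the highest-priority pending real-time task. -/
  | removeNextRealTime (s : DriverState Task) (i k : Task)
      (hk : k ∈ S.highest (s.pending.filter fun j => S.IsRealTime j)) :
      gcaps S s (.segEnd i) ⟨(insert k s.running).erase i, s.pending.erase k⟩
  /-- A segment ends, and no real-time task is pending: all remaining tasks share the GPU. -/
  | removeNoRealTime (s : DriverState Task) (i : Task)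
      (hp : ∀ k ∈ s.pending, ¬ S.IsRealTime k) :
      gcaps S s (.segEnd i) ⟨s.running.erase i ∪ s.pending, ∅⟩

end Policy

/-- Progress of a task: no job, or a job that has completed `j` GPU segments and is now
outside a GPU segment (`cpu j`) or inside the next one (`gpu j`). -/
inductive Phase
  | noJob
  | cpu (j : ℕ)
  | gpu (j : ℕ)

/-- State of the driver, of the GPU and of all tasks. -/
structure State (Task : Type*) where
  drv : DriverState Task
  /-- The runlist held by the hardware, rotated so that its head is the current TSG. -/
  runlist : List Task
  /-- The part of the current time slice that is used up. -/
  used : ℝ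
  phase : Task → Phase
  /-- GPU work that the current GPU segment of a task may still submit. -/
  budget : Task → ℝ
  /-- GPU work that a task has submitted to its TSG and that has not been executed. -/
  backlog : Task → ℝ

/-- What happens in one step. -/
inductive Activity (Task : Type*)
  /-- a job of `i` starts -/
  | jobStart (i : Task)
  /-- a job of `i` is completed -/
  | jobEnd (i : Task)
  /-- `i` submits GPU commands to its TSG -/
  | submit (i : Task)
  /-- the driver handles a request and replaces the runlist -/
  | update (r : Request Task)
  /-- the GPU executes commands of the TSG of `i` -/
  | exec (i : Task)
  /-- the GPU moves from the TSG of `i` to that of `j` within the runlist -/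
  | switch (i j : Task)
  /-- the only active TSG on the runlist gets a new time slice -/
  | renew
  /-- no TSG on the runlist has commands to execute -/
  | idle

section Semantics

variable {Task : Type*} [DecidableEq Task]

/-- `l` is a runlist that has exactly one entry for every running task, in any order. -/
def IsRunlistOf (l : List Task) (d : DriverState Task) : Prop :=
  l.Nodup ∧ ∀ i, i ∈ l ↔ i ∈ d.running

/-- `Step S drv s a d s'`: under the driver policy `drv` the activity `a`, of duration `d`, leads
from `s` to `s'`. The TSGs on the runlist are served round-robin in time slices. Everything on
the CPU side (arrivals, CPU scheduling, busy-waiting or self-suspension) is unconstrained. -/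
inductive Step (S : System Task) (drv : Driver Task) :
    State Task → Activity Task → ℝ → State Task → Prop
  | jobStart (s : State Task) (i : Task) (hp : s.phase i = .noJob) :
      Step S drv s (.jobStart i) 0 { s with phase := Function.update s.phase i (.cpu 0) }
  | jobEnd (s : State Task) (i : Task) (hp : s.phase i = .cpu (S.numSeg i)) :
      Step S drv s (.jobEnd i) 0 { s with phase := Function.update s.phase i .noJob }
  | submit (s : State Task) (i : Task) (j : ℕ) (w : ℝ) (hp : s.phase i = .gpu j)
      (hw : 0 < w) (hb : w ≤ s.budget i) :
      Step S drv s (.submit i) 0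
        { s with
          budget := Function.update s.budget i (s.budget i - w)
          backlog := Function.update s.backlog i (s.backlog i + w) }
  | segBegin (s : State Task) (i : Task) (j : Fin (S.numSeg i)) (d' : DriverState Task)
      (l : List Task) (d : ℝ) (hp : s.phase i = .cpu j)
      (hd : drv s.drv (.segBegin i) d') (hl : IsRunlistOf l d') (h0 : 0 ≤ d)
      (h1 : d ≤ S.epsilon) :
      Step S drv s (.update (.segBegin i)) d
        { s with
          drv := d'
          runlist := l
          used := 0
          phase := Function.update s.phase i (.gpu j)
          budget := Function.update s.budget i (S.pureGpu i j) }
  /-- A segment is completed when its commands have been executed; its task is on the list of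
  running tasks, from which it is to be removed. -/
  | segEnd (s : State Task) (i : Task) (j : ℕ) (d' : DriverState Task)
      (l : List Task) (d : ℝ) (hp : s.phase i = .gpu j) (hb : s.backlog i = 0)
      (hr : i ∈ s.drv.running) (hd : drv s.drv (.segEnd i) d') (hl : IsRunlistOf l d')
      (h0 : 0 ≤ d) (h1 : d ≤ S.epsilon) :
      Step S drv s (.update (.segEnd i)) d
        { s with
          drv := d'
          runlist := l
          used := 0
          phase := Function.update s.phase i (.cpu (j + 1))
          budget := Function.update s.budget i 0 }
  | exec (s : State Task) (i : Task) (t : List Task) (d : ℝ) (hl : s.runlist = i :: t)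
      (h0 : 0 < d) (hb : d ≤ s.backlog i) (hu : s.used + d ≤ S.slice) :
      Step S drv s (.exec i) d
        { s with
          used := s.used + d
          backlog := Function.update s.backlog i (s.backlog i - d) }
  /-- The slice of `i` is used up or `i` has no commands left: move on to the next TSG that has
  commands. The overhead `theta` is an upper bound (a runlist update may cut a switch short). -/
  | switch (s : State Task) (i j : Task) (t post : List Task) (d : ℝ)
      (hl : s.runlist = i :: t ++ j :: post) (hi : s.used = S.slice ∨ s.backlog i = 0)
      (ht : ∀ k ∈ t, s.backlog k = 0) (hj : 0 < s.backlog j) (h0 : 0 ≤ d) (h1 : d ≤ S.theta) :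
      Step S drv s (.switch i j) d { s with runlist := j :: post ++ i :: t, used := 0 }
  | renew (s : State Task) (i : Task) (t : List Task) (hl : s.runlist = i :: t)
      (hu : s.used = S.slice) (ht : ∀ k ∈ t, s.backlog k = 0) :
      Step S drv s .renew 0 { s with used := 0 }
  | idle (s : State Task) (d : ℝ) (hb : ∀ k ∈ s.runlist, s.backlog k = 0) (h0 : 0 ≤ d) :
      Step S drv s .idle d s

/-- Initially there are no jobs, and the GPU is idle. -/
def initState : State Task where
  drv := ⟨∅, ∅⟩
  runlist := []
  used := 0
  phase := fun _ => .noJob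
  budget := fun _ => 0
  backlog := fun _ => 0

/-- One entry of an execution trace: the state before the step, the activity, its duration. -/
structure Entry (Task : Type*) where
  pre : State Task
  act : Activity Task
  dur : ℝ

/-- `Run S drv tr s`: the trace `tr` is a finite execution from the initial state to `s`. -/
inductive Run (S : System Task) (drv : Driver Task) : List (Entry Task) → State Task → Prop
  | nil : Run S drv [] initState
  | snoc (tr : List (Entry Task)) (s s' : State Task) (a : Activity Task) (d : ℝ)
      (h : Run S drv tr s) (hs : Step S drv s a d s') : Run S drv (tr ++ [⟨s, a, d⟩]) s'

/-- The time that `i` loses to interleaved execution in one step: the TSG of `i` is on the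
runlist and has commands to execute, but the GPU executes another TSG of the runlist, or switches
from one TSG of the runlist to another. (Time in which `i` is not on the runlist is preemption,
and time spent in runlist updates is accounted for by `epsilon`.) -/
noncomputable def Entry.ieDelay (i : Task) (e : Entry Task) : ℝ :=
  open Classical in
  if i ∈ e.pre.runlist ∧ 0 < e.pre.backlog i then
    match e.act with
    | .exec j => if j = i then 0 else e.dur
    | .switch _ _ => e.dur
    | _ => 0
  else 0

/-- A part of a trace that starts with a job of `i` and does not reach the next job of `i`. -/
def IsJobWindow (i : Task) : List (Entry Task) → Prop
  | [] => False
  | e :: w => e.act = .jobStart i ∧ ∀ e' ∈ w, e'.act ≠ .jobStart i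

/-- The worst-case interference `I^ie_i` from interleaved execution for a task under a driver
policy: the supremum, over all executions and all jobs of the task in them, of the total time
the job loses to interleaved execution. -/
noncomputable def interleavedInterference (S : System Task) (drv : Driver Task) (i : Task) :
    ENNReal :=
  ⨆ (tr : List (Entry Task)) (s : State Task) (_ : Run S drv tr s) (w : List (Entry Task))
    (_ : w <:+: tr) (_ : IsJobWindow i w), ENNReal.ofReal (w.map (Entry.ieDelay i)).sum

end Semantics

end GCAPS

/-! Under GCAPS the driver lists are always in one of two modes: either no listed task is real-time,
or exactly one task is running and it is real-time. In both modes all running tasks have the same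
GPU priority, so an arriving real-time task of higher priority preempts all of them and runs alone;
and when the only running real-time task ends, either the next real-time task takes its place or
only best-effort tasks are left. The replacement works because the ending task is not also pending:
listed tasks are inside a GPU segment, so a task that begins one is on neither list. A real-time
task on the runlist is therefore its only entry, and the GPU has no other TSG to execute or to
switch to. -/

namespace GCAPS

variable {Task : Type*} {S : System Task} {i : Task}

theorem System.isRealTime_iff_gpuPrio_pos : S.IsRealTime i ↔ 0 < S.gpuPrio i :=
  (S.gpuPrio_pos_iff i).symm

theorem System.not_isRealTime_iff_gpuPrio_eq_zero : ¬ S.IsRealTime i ↔ S.gpuPrio i = 0 := by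
  rw [System.isRealTime_iff_gpuPrio_pos, Nat.pos_iff_ne_zero, not_not]

theorem System.highest_subset (S : System Task) (A : Finset Task) : S.highest A ⊆ A :=
  Finset.filter_subset _ A

theorem System.highest_eq_self_iff {A : Finset Task} :
    S.highest A = A ↔ ∀ h ∈ A, ∀ h' ∈ A, S.gpuPrio h' ≤ S.gpuPrio h :=
  Finset.filter_eq_self

section Policy

variable [DecidableEq Task] {d d' : DriverState Task}

/-- The tasks that the driver keeps track of, on either of its two lists. -/
def DriverState.tracked (d : DriverState Task) : Finset Task :=
  d.running ∪ d.pending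

/-- `P` holds initially and is preserved by `drv`, which moreover adds only the requesting task to
its lists when a segment begins, and drops it when its segment ends. Only requests that can occur
in an execution count: an untracked task begins a segment, or a running task ends one. -/
structure Driver.IsInvariant (drv : Driver Task) (P : DriverState Task → Prop) : Prop where
  empty : P ⟨∅, ∅⟩
  segBegin {d d' : DriverState Task} {i : Task} :
    P d → i ∉ d.tracked → drv d (.segBegin i) d' → P d'
  segBegin_tracked {d d' : DriverState Task} {i : Task} :
    P d → i ∉ d.tracked → drv d (.segBegin i) d' → d'.tracked ⊆ insert i d.tracked
  segEnd {d d' : DriverState Task} {i : Task} :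
    P d → i ∈ d.running → drv d (.segEnd i) d' → P d'
  segEnd_tracked {d d' : DriverState Task} {i : Task} :
    P d → i ∈ d.running → drv d (.segEnd i) d' → d'.tracked ⊆ d.tracked.erase i

/-- The two modes of the driver under GCAPS: it tracks best-effort tasks only, or a real-time task
is the only running one. -/
def DriverState.ServesRealTimeAlone (S : System Task) (d : DriverState Task) : Prop :=
  (∀ h ∈ d.tracked, ¬ S.IsRealTime h) ∨ ∃ k, S.IsRealTime k ∧ d.running = {k}

namespace DriverState.ServesRealTimeAlone

theorem running_eq_singleton (h : d.ServesRealTimeAlone S) (hi : S.IsRealTime i)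
    (hmem : i ∈ d.running) : d.running = {i} := by
  rcases h with bestEffort | ⟨k, -, hk⟩
  · exact absurd hi (bestEffort i (Finset.mem_union_left _ hmem))
  · rw [hk, Finset.mem_singleton] at hmem
    rw [hk, hmem]

theorem highest_running (h : d.ServesRealTimeAlone S) : S.highest d.running = d.running := by
  rw [System.highest_eq_self_iff]
  intro m hm m' hm'
  rcases h with bestEffort | ⟨k, -, hk⟩
  · have hzero := bestEffort m' (Finset.mem_union_left _ hm')
    rw [System.not_isRealTime_iff_gpuPrio_eq_zero] at hzero
    exact hzero.trans_le (Nat.zero_le _)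
  · rw [hk, Finset.mem_singleton] at hm hm'
    rw [hm, hm']

end DriverState.ServesRealTimeAlone

namespace gcaps

theorem tracked_segBegin (h : gcaps S d (.segBegin i) d') : d'.tracked = insert i d.tracked := by
  cases h with
  | addBestEffortRunning => exact Finset.insert_union _ _ _
  | addBestEffortPending => exact Finset.union_insert _ _ _
  | addRealTimeRunning =>
    have preempted := S.highest_subset d.running
    simp only [DriverState.tracked]
    grind
  | addRealTimePending => exact Finset.union_insert _ _ _

theorem tracked_segEnd (h : gcaps S d (.segEnd i) d') (hi : i ∉ d.pending) :
    d'.tracked = d.tracked.erase i := by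
  cases h with
  | removeNextRealTime _ _ k hk =>
    have pending : k ∈ d.pending := Finset.mem_of_mem_filter k (S.highest_subset _ hk)
    simp only [DriverState.tracked]
    grind
  | removeNoRealTime =>
    simp only [DriverState.tracked, Finset.union_empty, Finset.erase_union_distrib,
      Finset.erase_eq_of_notMem hi]

theorem disjoint_segBegin (h : gcaps S d (.segBegin i) d') (hd : Disjoint d.running d.pending)
    (hi : i ∉ d.tracked) : Disjoint d'.running d'.pending := by
  rw [DriverState.tracked, Finset.notMem_union] at hi
  rw [Finset.disjoint_left] at hd ⊢
  cases h <;> grind [System.highest_subset]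

theorem disjoint_segEnd (h : gcaps S d (.segEnd i) d') (hd : Disjoint d.running d.pending) :
    Disjoint d'.running d'.pending := by
  rw [Finset.disjoint_left] at hd ⊢
  cases h <;> grind

theorem servesRealTimeAlone_segBegin (h : gcaps S d (.segBegin i) d')
    (hd : d.ServesRealTimeAlone S) : d'.ServesRealTimeAlone S := by
  have tracked := tracked_segBegin h
  cases h with
  | addBestEffortRunning _ _ hi hr =>
    rcases hd with bestEffort | ⟨k, hk, hrun⟩
    · left
      rw [tracked]
      exact Finset.forall_mem_insert _ _ _ |>.2 ⟨hi, bestEffort⟩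
    · exact absurd hk (hr k (by simp [hrun]))
  | addBestEffortPending _ _ _ hr =>
    obtain ⟨k, hmem, hk⟩ := hr
    exact .inr ⟨k, hk, hd.running_eq_singleton hk hmem⟩
  | addRealTimeRunning _ _ hi _ =>
    refine .inr ⟨i, hi, ?_⟩
    rw [hd.highest_running, Finset.sdiff_self, insert_empty_eq]
  | addRealTimePending _ _ hi hr =>
    obtain ⟨k, hmem, hle⟩ := hr
    rw [System.isRealTime_iff_gpuPrio_pos] at hi
    have hk : S.IsRealTime k := System.isRealTime_iff_gpuPrio_pos.2 (hi.trans_le hle)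
    exact .inr ⟨k, hk, hd.running_eq_singleton hk (S.highest_subset _ hmem)⟩

theorem servesRealTimeAlone_segEnd (h : gcaps S d (.segEnd i) d')
    (hd : d.ServesRealTimeAlone S) (hr : i ∈ d.running) (hp : i ∉ d.pending) :
    d'.ServesRealTimeAlone S := by
  have tracked := tracked_segEnd h hp
  rcases hd with bestEffort | ⟨m, -, hrun⟩
  · left
    rw [tracked]
    exact fun k hk => bestEffort k (Finset.mem_of_mem_erase hk)
  obtain rfl : i = m := by rwa [hrun, Finset.mem_singleton] at hr
  cases h with
  | removeNextRealTime _ _ k hk =>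
    obtain ⟨pending, realTime⟩ := Finset.mem_filter.1 (S.highest_subset _ hk)
    have hki : k ≠ i := ne_of_mem_of_not_mem pending hp
    refine .inr ⟨k, realTime, ?_⟩
    rw [hrun, Finset.erase_insert_of_ne hki, Finset.erase_singleton, insert_empty_eq]
  | removeNoRealTime _ _ bestEffort =>
    left
    simpa [DriverState.tracked, hrun] using bestEffort

theorem isInvariant (S : System Task) :
    (gcaps S).IsInvariant fun d => Disjoint d.running d.pending ∧ d.ServesRealTimeAlone S where
  empty := ⟨Finset.disjoint_empty_left _, .inl (by simp [DriverState.tracked])⟩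
  segBegin hd hi h := ⟨disjoint_segBegin h hd.1 hi, servesRealTimeAlone_segBegin h hd.2⟩
  segBegin_tracked _ _ h := (tracked_segBegin h).subset
  segEnd hd hi h :=
    ⟨disjoint_segEnd h hd.1,
      servesRealTimeAlone_segEnd h hd.2 hi (Finset.disjoint_left.1 hd.1 hi)⟩
  segEnd_tracked hd hi h := (tracked_segEnd h (Finset.disjoint_left.1 hd.1 hi)).subset

end gcaps

end Policy

theorem IsRunlistOf.of_perm {l l' : List Task} {d : DriverState Task} (hl : IsRunlistOf l d)
    (h : l'.Perm l) : IsRunlistOf l' d :=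
  ⟨h.nodup_iff.2 hl.1, fun k => h.mem_iff.trans (hl.2 k)⟩

theorem IsRunlistOf.eq_singleton {l : List Task} {d : DriverState Task} (hl : IsRunlistOf l d)
    (h : d.running = {i}) : l = [i] := by
  refine List.perm_singleton.1 ((List.perm_ext_iff_of_nodup hl.1 (List.nodup_singleton i)).2 ?_)
  intro k
  rw [hl.2 k, h, Finset.mem_singleton, List.mem_singleton]

section Semantics

variable [DecidableEq Task] {drv : Driver Task} {P : DriverState Task → Prop}
  {s s' : State Task} {a : Activity Task} {t : ℝ} {tr : List (Entry Task)}

theorem Step.isRunlistOf (h : Step S drv s a t s') (hs : IsRunlistOf s.runlist s.drv) :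
    IsRunlistOf s'.runlist s'.drv := by
  cases h with
  | segBegin _ _ _ _ _ _ _ hl => exact hl
  | segEnd _ _ _ _ _ _ _ _ _ hl => exact hl
  | switch _ _ _ _ _ hl => exact hs.of_perm (hl ▸ List.perm_append_comm)
  | _ => exact hs

theorem Run.isRunlistOf (h : Run S drv tr s) : IsRunlistOf s.runlist s.drv := by
  induction h with
  | nil => simp [IsRunlistOf, initState]
  | snoc _ _ _ _ _ _ hs ih => exact hs.isRunlistOf ih

/-- The driver tracks only tasks that are inside a GPU segment. -/
def State.TracksSegments (s : State Task) : Prop :=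
  ∀ k ∈ s.drv.tracked, ∃ j, s.phase k = .gpu j

theorem State.TracksSegments.notMem_tracked (hs : s.TracksSegments)
    (hi : ∀ j, s.phase i ≠ .gpu j) : i ∉ s.drv.tracked := fun hmem =>
  (hs i hmem).elim hi

theorem Phase.exists_update_eq_gpu {phase : Task → Phase} {A : Finset Task} {p : Phase}
    (hphase : ∀ k ∈ A, ∃ j, phase k = .gpu j) (hi : i ∉ A) :
    ∀ k ∈ A, ∃ j, Function.update phase i p k = .gpu j := fun k hk => by
  rw [Function.update_of_ne (ne_of_mem_of_not_mem hk hi)]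
  exact hphase k hk

theorem Driver.IsInvariant.tracksSegments_of_step (hP : drv.IsInvariant P)
    (h : Step S drv s a t s') (hd : P s.drv) (hs : s.TracksSegments) : s'.TracksSegments := by
  cases h with
  | jobStart i hp => exact Phase.exists_update_eq_gpu hs (hs.notMem_tracked (by simp [hp]))
  | jobEnd i hp => exact Phase.exists_update_eq_gpu hs (hs.notMem_tracked (by simp [hp]))
  | segBegin i j _ _ _ hp hdrv =>
    have hi : i ∉ s.drv.tracked := hs.notMem_tracked (by simp [hp])
    intro k hk
    rcases Finset.mem_insert.1 (hP.segBegin_tracked hd hi hdrv hk) with rfl | hk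
    · exact ⟨j, Function.update_self ..⟩
    · exact Phase.exists_update_eq_gpu hs hi k hk
  | segEnd i _ _ _ _ _ _ hr hdrv =>
    have hphase : ∀ k ∈ s.drv.tracked.erase i, ∃ j, s.phase k = .gpu j :=
      fun k hk => hs k (Finset.mem_of_mem_erase hk)
    exact fun k hk => Phase.exists_update_eq_gpu hphase (Finset.notMem_erase i _) k
      (hP.segEnd_tracked hd hr hdrv hk)
  | _ => exact hs

theorem Driver.IsInvariant.of_step (hP : drv.IsInvariant P)
    (h : Step S drv s a t s') (hd : P s.drv) (hs : s.TracksSegments) : P s'.drv := by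
  cases h with
  | segBegin _ _ _ _ _ hp hdrv => exact hP.segBegin hd (hs.notMem_tracked (by simp [hp])) hdrv
  | segEnd _ _ _ _ _ _ _ hr hdrv => exact hP.segEnd hd hr hdrv
  | _ => exact hd

theorem Driver.IsInvariant.of_run (hP : drv.IsInvariant P) (h : Run S drv tr s) : P s.drv := by
  suffices P s.drv ∧ s.TracksSegments from this.1
  induction h with
  | nil => exact ⟨hP.empty, by simp [State.TracksSegments, DriverState.tracked, initState]⟩
  | snoc _ _ _ _ _ _ hs ih =>
    exact ⟨hP.of_step hs ih.1 ih.2, hP.tracksSegments_of_step hs ih.1 ih.2⟩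

theorem Run.exists_step_of_mem (h : Run S drv tr s) {e : Entry Task} (he : e ∈ tr) :
    ∃ tr' s', Run S drv tr' e.pre ∧ Step S drv e.pre e.act e.dur s' := by
  induction h with
  | nil => exact absurd he List.not_mem_nil
  | snoc tr s s' a t hrun hs ih =>
    rcases List.mem_append.1 he with he | he
    · exact ih he
    · obtain rfl := List.mem_singleton.1 he
      exact ⟨tr, s', hrun, hs⟩

theorem Step.ieDelay_eq_zero (h : Step S drv s a t s') (alone : i ∈ s.runlist → s.runlist = [i]) :
    Entry.ieDelay i ⟨s, a, t⟩ = 0 := by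
  unfold Entry.ieDelay
  split_ifs with hmem
  · have hrunlist := alone hmem.1
    cases h with
    | exec j _ _ hl =>
      obtain rfl : i = j := (List.cons.inj (hrunlist.symm.trans hl)).1
      exact if_pos rfl
    | switch _ _ _ _ _ hl => simp [hrunlist] at hl
    | _ => rfl
  · rfl

theorem interleavedInterference_eq_zero
    (alone : ∀ tr s, Run S drv tr s → i ∈ s.runlist → s.runlist = [i]) :
    interleavedInterference S drv i = 0 := by
  simp only [interleavedInterference, ENNReal.iSup_eq_zero, ENNReal.ofReal_eq_zero]
  intro tr s hrun w hw _
  refine (List.sum_eq_zero fun x hx => ?_).le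
  obtain ⟨e, he, rfl⟩ := List.mem_map.1 hx
  obtain ⟨tr', s', hrun', hstep⟩ := hrun.exists_step_of_mem (hw.subset he)
  exact hstep.ieDelay_eq_zero (alone tr' e.pre hrun')

theorem Run.runlist_eq_singleton (h : Run S (gcaps S) tr s) (hi : S.IsRealTime i)
    (hmem : i ∈ s.runlist) : s.runlist = [i] :=
  have runlist := h.isRunlistOf
  have serves := ((gcaps.isInvariant S).of_run h).2
  runlist.eq_singleton (serves.running_eq_singleton hi ((runlist.2 i).1 hmem))

end Semantics

end GCAPS

theorem lemma9 {Task : Type*} [DecidableEq Task] (S : GCAPS.System Task)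
    (i : Task) (hi : S.IsRealTime i) :
    (∀ (tr : List (GCAPS.Entry Task)) (s : GCAPS.State Task),
        GCAPS.Run S (GCAPS.gcaps S) tr s → i ∈ s.runlist → s.runlist = [i]) ∧
      GCAPS.interleavedInterference S (GCAPS.gcaps S) i = 0 := by
  have alone (tr : List (GCAPS.Entry Task)) (s : GCAPS.State Task)
      (h : GCAPS.Run S (GCAPS.gcaps S) tr s) : i ∈ s.runlist → s.runlist = [i] :=
    h.runlist_eq_singleton hi
  exact ⟨alone, GCAPS.interleavedInterference_eq_zero alone⟩
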